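/- Let $p\in\mathbb N$, let $H$ and $G_1,\dots,G_p$ be separable real Hilbert spaces, and let $G=G_1\oplus\cdots\oplus G_p$ be their Hilbert direct sum (of the $G_k$). For a real Hilbert space $X$, let $\Gamma_0(X)$ be the set of lower semicontinuous convex functions $h\colon X\to\,]-\infty,+\infty]$ whose domain $\operatorname{dom}h=\{x\in X : h(x)<+\infty\}$ is nonempty, and for $h\in\Gamma_0(X)$ let $$\partial h\colon X\to 2^X\colon x\mapsto\{u\in X : (\forall z\in X)\ \langle z-x,u\rangle+h(x)\le h(z)\}.$$ Let $f\in\Gamma_0(H)$ and, for every $k\in\{1,\dots,p\}$, let $g_k\in\Gamma_0(G_k)$ and let $L_k\colon H\to G_k$ be a nonzero bounded linear operator with adjoint $L_k^*$. Set $$S=\{(L_kx-y_k)_{1\le k\le p} : x\in\operatorname{dom}f,\ (\forall k)\ y_k\in\operatorname{dom}g_k\}\subset G.$$ Suppose that: 1. $f(x)+\sum_{k=1}^p g_k(L_kx)\to+\infty$ as $\|x\|\to+\infty$; 2. at least one of the following holds: (a) the cone generated by $S$, that is $\{ts : t>0,\ s\in S\}$, is a closed vector subspace of $G$; (b) for every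 $k\in\{1,\dots,p\}$, $g_k$ is real-valued; (c) $H$ and $G_1,\dots,G_p$ are finite-dimensional, and there exists $x\in\operatorname{ri}\operatorname{dom}f$ such that $L_kx\in\operatorname{ri}\operatorname{dom}g_k$ for every $k\in\{1,\dots,p\}$, where $\operatorname{ri}$ denotes the relative interior. Then there exists $x\in H$ such that $$0\in\partial f(x)+\sum_{k=1}^p L_k^*\bigl(\partial g_k(L_kx)\bigr),$$ that is, the set of zeros of $\partial f+\sum_{k=1}^pL_k^*\circ(\partial g_k)\circ L_k$ is nonempty. -/

import Mathlib

open Set Filter Topology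
open scoped Pointwise

namespace ConvexComposite

section Operators

variable {H : Type*} [NormedAddCommGroup H] [InnerProductSpace ℝ H]

/-- The effective domain `dom f = {x | f x < +∞}` of an extended-real-valued function. -/
def dom {E : Type*} (f : E → EReal) : Set E :=
  {x | f x < ⊤}

/-- The class `Γ₀(H)` of lower semicontinuous convex functions `f : H → ]-∞, +∞]` with nonempty
domain. Convexity is convexity of the epigraph `{(x, t) ∈ H × ℝ | f x ≤ t}`. -/
structure Gamma0 (f : H → EReal) : Prop where
  ne_bot : ∀ x, f x ≠ ⊥
  nonempty_dom : (dom f).Nonempty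
  lsc : LowerSemicontinuous f
  convex : Convex ℝ {q : H × ℝ | f q.1 ≤ (q.2 : EReal)}

/-- The subdifferential `∂f : H → 2^H` of `f`:
`∂f x = {u | ∀ z, ⟪z - x, u⟫ + f x ≤ f z}`. -/
def subdifferential (f : H → EReal) : H → Set H :=
  fun x => {u | ∀ z, ((inner ℝ (z - x) u : ℝ) : EReal) + f x ≤ f z}

/-- The set of zeros `zer A = {x | 0 ∈ A x}` of a set-valued operator `A : H → 2^H`. -/
def zer (A : H → Set H) : Set H :=
  {x | (0 : H) ∈ A x}

/-- The composition `L* ∘ B ∘ L : x ↦ {L* v | v ∈ B (L x)}`. -/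
noncomputable def compose {G : Type*} [NormedAddCommGroup G] [InnerProductSpace ℝ G]
    [CompleteSpace H] [CompleteSpace G] (L : H →L[ℝ] G) (B : G → Set G) : H → Set H :=
  fun x => (fun v => ContinuousLinearMap.adjoint L v) '' B (L x)

/-- The cone generated by `S`: the set of all `t • s` with `t > 0` and `s ∈ S`. -/
def coneGen {E : Type*} [AddCommGroup E] [Module ℝ E] (S : Set E) : Set E :=
  {z | ∃ t : ℝ, 0 < t ∧ ∃ s ∈ S, z = t • s}

/-- The set `{(L_k x - y_k)_k | x ∈ dom f, ∀ k, y_k ∈ dom g_k}`, as a subset of the Hilbert direct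
sum of the spaces `G_k`. -/
def diffSet {p : ℕ} {G : Fin p → Type*} [∀ k, NormedAddCommGroup (G k)]
    [∀ k, InnerProductSpace ℝ (G k)] (f : H → EReal) (g : ∀ k, G k → EReal)
    (L : ∀ k, H →L[ℝ] G k) : Set (PiLp 2 G) :=
  {s | ∃ x ∈ dom f, ∃ y : ∀ k, G k, (∀ k, y k ∈ dom (g k)) ∧
    s = WithLp.toLp 2 (fun k => L k x - y k)}

end Operators

end ConvexComposite

namespace ConvexComposite

/-! Coercivity and weak compactness of balls give a minimizer `x` of `f + ∑ g k ∘ L k`. It remains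
to split the optimality condition, which is where the qualification condition enters. Doubling
variables, `(x, (L k x)ₖ)` minimizes the separable `F (x, y) = f x + ∑ g k (y k)` subject to `T (x,
y) = (L k x - y k)ₖ = 0`, and `T '' dom F = S`. Each of (a), (b), (c) makes the cone of `S` a closed
subspace `V`. By Baire's theorem in `V`, the value function `v ↦ inf {F z | T z = v}` is bounded
above near `0` (`exists_forall_norm_lt_exists_le`), so Hahn-Banach yields a multiplier `w`
(`exists_multiplier`). Varying one variable at a time in the multiplier inequality gives `∑ (L k)*
(w k) ∈ ∂f x` and `-w k ∈ ∂(g k) (L k x)`; the terms cancel (`mem_zer_of_multiplier`). -/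

/-- Lower semicontinuous convex functions with values in `]-∞, +∞]`, possibly identically `+∞`. -/
structure IsLscConvex {E : Type*} [NormedAddCommGroup E] [InnerProductSpace ℝ E]
    (f : E → EReal) : Prop where
  ne_bot : ∀ x, f x ≠ ⊥
  lsc : LowerSemicontinuous f
  convex : Convex ℝ {q : E × ℝ | f q.1 ≤ (q.2 : EReal)}

/-! ### Calculus of extended-real-valued lsc convex functions. -/

section Basic

variable {E E' : Type*} [NormedAddCommGroup E] [InnerProductSpace ℝ E]
  [NormedAddCommGroup E'] [InnerProductSpace ℝ E']

theorem Gamma0.isLscConvex {f : E → EReal} (hf : Gamma0 f) : IsLscConvex f :=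
  ⟨hf.ne_bot, hf.lsc, hf.convex⟩

namespace IsLscConvex

theorem combo_le {f : E → EReal} (hf : IsLscConvex f) {x y : E} {s t a b : ℝ}
    (hx : f x ≤ (s : EReal)) (hy : f y ≤ (t : EReal)) (ha : 0 ≤ a) (hb : 0 ≤ b) (hab : a + b = 1) :
    f (a • x + b • y) ≤ ((a * s + b * t : ℝ) : EReal) := by
  have := hf.convex (x := (x, s)) hx (y := (y, t)) hy ha hb hab
  simpa using this

theorem exists_coe_eq {f : E → EReal} (hf : IsLscConvex f) {x : E} (hx : x ∈ dom f) :
    ∃ r : ℝ, f x = r := by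
  lift f x to ℝ using ⟨ne_of_lt hx, hf.ne_bot x⟩ with r hr
  exact ⟨r, rfl⟩

theorem zero : IsLscConvex (fun _ : E => (0 : EReal)) where
  ne_bot _ := EReal.zero_ne_bot
  lsc := lowerSemicontinuous_const
  convex := by
    rintro ⟨x, s⟩ hs ⟨y, t⟩ ht a b ha hb -
    simp only [mem_ofPred_eq, ← EReal.coe_zero, EReal.coe_le_coe_iff, Prod.snd_add, Prod.smul_snd,
      smul_eq_mul] at *
    positivity

theorem add {f g : E → EReal} (hf : IsLscConvex f) (hg : IsLscConvex g) :
    IsLscConvex (fun x => f x + g x) where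
  ne_bot x := by simp [EReal.add_eq_bot_iff, hf.ne_bot x, hg.ne_bot x]
  -- Addition on `EReal` is discontinuous only at `(⊤, ⊥)` and `(⊥, ⊤)`, excluded here.
  lsc := hf.lsc.add' hg.lsc fun x =>
    EReal.continuousAt_add (Or.inr (hg.ne_bot x)) (Or.inl (hf.ne_bot x))
  convex := by
    have key : ∀ (x : E) (s : ℝ), f x + g x ≤ s → ∃ p q : ℝ, f x = p ∧ g x = q ∧ p + q ≤ s := by
      intro x s h
      obtain ⟨hft, hgt⟩ := (EReal.add_ne_top_iff_ne_top₂ (hf.ne_bot x) (hg.ne_bot x)).1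
        (h.trans_lt (EReal.coe_lt_top s)).ne
      obtain ⟨p, hp⟩ := hf.exists_coe_eq hft.lt_top
      obtain ⟨q, hq⟩ := hg.exists_coe_eq hgt.lt_top
      refine ⟨p, q, hp, hq, ?_⟩
      rw [hp, hq] at h
      exact_mod_cast h
    rintro ⟨x, s⟩ hs ⟨y, t⟩ ht a b ha hb hab
    obtain ⟨p, q, hp, hq, hpq⟩ := key x s hs
    obtain ⟨p', q', hp', hq', hpq'⟩ := key y t ht
    have h1 := hf.combo_le hp.le hp'.le ha hb hab
    have h2 := hg.combo_le hq.le hq'.le ha hb hab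
    refine (add_le_add h1 h2).trans ?_
    simp only [Prod.snd_add, Prod.smul_snd, smul_eq_mul]
    norm_cast
    nlinarith

theorem comp {f : E' → EReal} (hf : IsLscConvex f) (A : E →L[ℝ] E') :
    IsLscConvex (fun x => f (A x)) where
  ne_bot x := hf.ne_bot _
  lsc := hf.lsc.comp A.continuous
  convex := by
    rintro ⟨x, s⟩ hs ⟨y, t⟩ ht a b ha hb hab
    have := hf.combo_le hs ht ha hb hab
    simpa using this

theorem sum {ι : Type*} {f : ι → E → EReal} (hf : ∀ i, IsLscConvex (f i)) (s : Finset ι) :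
    IsLscConvex (fun x => ∑ i ∈ s, f i x) := by
  classical
  induction s using Finset.induction_on with
  | empty => simpa using zero
  | insert i s hi ih => simpa [Finset.sum_insert hi] using (hf i).add ih

theorem convex_sublevel {f : E → EReal} (hf : IsLscConvex f) (r : ℝ) :
    Convex ℝ {x | f x ≤ (r : EReal)} := by
  intro x hx y hy a b ha hb hab
  have := hf.combo_le hx hy ha hb hab
  rwa [← add_mul, hab, one_mul] at this

theorem isClosed_sublevel {f : E → EReal} (hf : IsLscConvex f) (r : EReal) :
    IsClosed {x | f x ≤ r} :=
  hf.lsc.isClosed_preimage r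

theorem convex_dom {f : E → EReal} (hf : IsLscConvex f) : Convex ℝ (dom f) := by
  intro x hx y hy a b ha hb hab
  obtain ⟨s, hs⟩ := hf.exists_coe_eq hx
  obtain ⟨t, ht⟩ := hf.exists_coe_eq hy
  exact (hf.combo_le hs.le ht.le ha hb hab).trans_lt (EReal.coe_lt_top _)

end IsLscConvex

theorem sum_ne_bot {ι : Type*} {s : Finset ι} {a : ι → EReal} (ha : ∀ i ∈ s, a i ≠ ⊥) :
    ∑ i ∈ s, a i ≠ ⊥ :=
  Finset.sum_induction a (· ≠ ⊥) (fun x y hx hy => by simp [EReal.add_eq_bot_iff, hx, hy])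
    EReal.zero_ne_bot ha

/-- A finite sum of values in `]-∞, +∞]` is `< +∞` iff every term is. -/
theorem sum_lt_top_iff {ι : Type*} {s : Finset ι} {a : ι → EReal} (ha : ∀ i ∈ s, a i ≠ ⊥) :
    ∑ i ∈ s, a i < ⊤ ↔ ∀ i ∈ s, a i < ⊤ := by
  classical
  induction s using Finset.induction_on with
  | empty => simp
  | insert i s hi ih =>
    have ha' : ∀ j ∈ s, a j ≠ ⊥ := fun j hj => ha j (Finset.mem_insert_of_mem hj)
    rw [Finset.sum_insert hi, lt_top_iff_ne_top, EReal.add_ne_top_iff_ne_top₂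
      (ha i (Finset.mem_insert_self _ _)) (sum_ne_bot ha'), ← lt_top_iff_ne_top,
      ← lt_top_iff_ne_top, ih ha', Finset.forall_mem_insert]

end Basic

/-! ### Weak compactness and existence of minimizers. -/

section WeakCompactness

variable {E : Type*} [NormedAddCommGroup E] [InnerProductSpace ℝ E]

theorem isClosed_toWeakSpace_image {K : Set E} (hK : Convex ℝ K) (hc : IsClosed K) :
    IsClosed (toWeakSpace ℝ E '' K) := by
  rw [← closure_eq_iff_isClosed, ← Convex.toWeakSpace_closure ℝ hK, hc.closure_eq]

variable [CompleteSpace E]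

/-- Reflexivity of Hilbert spaces, by using the Riesz representation twice. -/
theorem surjective_inclusionInDoubleDualWeak :
    Function.Surjective (NormedSpace.inclusionInDoubleDualWeak ℝ E) := by
  intro φ
  let ψ : StrongDual ℝ (StrongDual ℝ E) := WeakDual.toStrongDual φ
  let ψ' : StrongDual ℝ E :=
    ψ.comp (InnerProductSpace.toDual ℝ E).toContinuousLinearEquiv.toContinuousLinearMap
  refine ⟨toWeakSpace ℝ E ((InnerProductSpace.toDual ℝ E).symm ψ'), ?_⟩
  refine DFunLike.ext _ _ fun l => ?_
  obtain ⟨y, rfl⟩ := (InnerProductSpace.toDual ℝ E).surjective l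
  have h : inner ℝ ((InnerProductSpace.toDual ℝ E).symm ψ') y = ψ' y :=
    InnerProductSpace.toDual_symm_apply
  change InnerProductSpace.toDual ℝ E y ((InnerProductSpace.toDual ℝ E).symm ψ') = ψ' y
  rw [InnerProductSpace.toDual_apply_apply, real_inner_comm, h]

theorem isCompact_toWeakSpace_image {K : Set E} (hK : Convex ℝ K) (hc : IsClosed K)
    (hb : Bornology.IsBounded K) : IsCompact (toWeakSpace ℝ E '' K) := by
  have := NormedSpace.isCompact_closure_of_isBounded ℝ E (toWeakSpace ℝ E '' K)
    (by rwa [(toWeakSpace ℝ E).injective.preimage_image])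
    (by rw [surjective_inclusionInDoubleDualWeak.range_eq]; exact subset_univ _)
  rwa [(isClosed_toWeakSpace_image hK hc).closure_eq] at this

/-- Continuous linear images of bounded closed convex subsets of a Hilbert space are closed. -/
theorem isClosed_image_of_convex {Y : Type*} [NormedAddCommGroup Y] [InnerProductSpace ℝ Y]
    (T : E →L[ℝ] Y) {K : Set E} (hK : Convex ℝ K) (hc : IsClosed K)
    (hb : Bornology.IsBounded K) : IsClosed (T '' K) := by
  -- `T` is weak-to-weak continuous, so the image is weakly compact, hence weakly closed, hence norm
  -- closed.
  have h1 : IsCompact (WeakSpace.map T '' (toWeakSpace ℝ E '' K)) :=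
    (isCompact_toWeakSpace_image hK hc hb).image (WeakSpace.map T).continuous
  have h2 : IsClosed (toWeakSpaceCLM ℝ Y ⁻¹' (WeakSpace.map T '' (toWeakSpace ℝ E '' K))) :=
    h1.isClosed.preimage (toWeakSpaceCLM ℝ Y).continuous
  convert h2 using 1
  ext y
  constructor
  · rintro ⟨x, hx, rfl⟩
    exact ⟨_, ⟨x, hx, rfl⟩, rfl⟩
  · rintro ⟨_, ⟨x, hx, rfl⟩, h⟩
    exact ⟨x, hx, h⟩

/-- Convex closed sublevel sets are weakly closed, so `h` is weakly lsc and attains its minimum on a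
closed ball. The ball contains `x₀`, and outside it `h` exceeds `h x₀`. -/
theorem IsLscConvex.exists_forall_le {h : E → EReal} (hh : IsLscConvex h) (hne : (dom h).Nonempty)
    (hco : Tendsto h (comap (fun x : E => ‖x‖) atTop) (𝓝 (⊤ : EReal))) :
    ∃ x, ∀ z, h x ≤ h z := by
  obtain ⟨x₀, hx₀⟩ := hne
  have hev : ∀ᶠ x in comap (fun x : E => ‖x‖) atTop, h x₀ < h x := hco.eventually (lt_mem_nhds hx₀)
  rw [eventually_comap, eventually_atTop] at hev
  obtain ⟨R, hR⟩ := hev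
  have hlsc : LowerSemicontinuous (fun x : WeakSpace ℝ E => h ((toWeakSpace ℝ E).symm x)) := by
    rw [lowerSemicontinuous_iff_isClosed_preimage]
    intro y
    have heq : (fun x : WeakSpace ℝ E => h ((toWeakSpace ℝ E).symm x)) ⁻¹' Iic y =
        toWeakSpace ℝ E '' {x | h x ≤ y} := by
      rw [LinearEquiv.image_eq_preimage_symm]
      rfl
    rw [heq]
    refine isClosed_toWeakSpace_image ?_ (hh.isClosed_sublevel y)
    induction y with
    | bot => simpa [hh.ne_bot] using convex_empty
    | top => simpa using convex_univ
    | coe r => exact hh.convex_sublevel r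
  obtain ⟨a, -, hmin⟩ := (hlsc.lowerSemicontinuousOn _).exists_isMinOn
    (s := toWeakSpace ℝ E '' Metric.closedBall 0 (max R ‖x₀‖))
    ⟨_, x₀, by simp, rfl⟩
    (isCompact_toWeakSpace_image (convex_closedBall _ _) Metric.isClosed_closedBall
      Metric.isBounded_closedBall)
  have hmin' : ∀ z ∈ Metric.closedBall (0 : E) (max R ‖x₀‖), h ((toWeakSpace ℝ E).symm a) ≤ h z := by
    intro z hz
    simpa using hmin (mem_image_of_mem (toWeakSpace ℝ E) hz)
  refine ⟨(toWeakSpace ℝ E).symm a, fun z => ?_⟩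
  by_cases hz : z ∈ Metric.closedBall (0 : E) (max R ‖x₀‖)
  · exact hmin' z hz
  · have hz' : R ≤ ‖z‖ := by
      simp only [mem_closedBall_zero_iff, not_le] at hz
      exact (le_max_left _ _).trans hz.le
    exact (hmin' x₀ (by simp)).trans (hR _ hz' z rfl).le

end WeakCompactness

/-! ### Value function and Lagrange multipliers. -/

section Perturbation

variable {E Y : Type*} [NormedAddCommGroup E] [InnerProductSpace ℝ E] [CompleteSpace E]
  [NormedAddCommGroup Y] [InnerProductSpace ℝ Y] [CompleteSpace Y]

/-- If the cone generated by `T (dom F)` is a closed subspace `V`, the perturbation function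
`v ↦ inf {F z | T z = v}` is bounded above on a neighborhood of the origin in `V`. -/
theorem IsLscConvex.exists_forall_norm_lt_exists_le {F : E → EReal} (hF : IsLscConvex F)
    (T : E →L[ℝ] Y) (V : Submodule ℝ Y) (hV : IsClosed (V : Set Y))
    (hcone : coneGen (T '' dom F) = (V : Set Y)) :
    ∃ N ε : ℝ, 0 < ε ∧ ∀ v ∈ V, ‖v‖ < ε → ∃ z, T z = v ∧ F z ≤ (N : EReal) := by
  have : CompleteSpace V := hV.completeSpace_coe
  obtain ⟨t₀, ht₀, _, ⟨z₀, hz₀, rfl⟩, h0⟩ : (0 : Y) ∈ coneGen (T '' dom F) :=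
    hcone ▸ V.zero_mem
  have hTz₀ : T z₀ = 0 := (smul_eq_zero.1 h0.symm).resolve_left ht₀.ne'
  obtain ⟨r₀, hr₀⟩ := hF.exists_coe_eq hz₀
  let K : ℕ → Set E := fun n => Metric.closedBall 0 n ∩ {z | F z ≤ ((n : ℝ) : EReal)}
  have hK : ∀ n, IsClosed (T '' K n) := fun n =>
    isClosed_image_of_convex T ((convex_closedBall _ _).inter (hF.convex_sublevel _))
      (Metric.isClosed_closedBall.inter (hF.isClosed_sublevel _))
      (Metric.isBounded_closedBall.subset inter_subset_left)
  -- The scaling lets the `D n` exhaust the cone; `n + 1` keeps the factor finite at `n = 0`.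
  let D : ℕ → Set V := fun n => {v | ((n : ℝ) + 1)⁻¹ • (v : Y) ∈ T '' K n}
  have hD : ∀ n, IsClosed (D n) := fun n =>
    (hK n).preimage (continuous_subtype_val.const_smul (((n : ℝ) + 1)⁻¹))
  have hDV : ⋃ n, D n = univ := by
    refine eq_univ_of_forall fun v => mem_iUnion.2 ?_
    obtain ⟨t, ht, _, ⟨z, hz, rfl⟩, hv⟩ : (v : Y) ∈ coneGen (T '' dom F) := hcone ▸ v.2
    obtain ⟨r, hr⟩ := hF.exists_coe_eq hz
    obtain ⟨n, hn⟩ := exists_nat_ge (max t (max (max ‖z‖ ‖z₀‖) (max r r₀)))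
    simp only [max_le_iff] at hn
    obtain ⟨htn, ⟨hzn, hz₀n⟩, hrn, hr₀n⟩ := hn
    have hn1 : (0 : ℝ) < n + 1 := by positivity
    have ha : 0 ≤ t / (n + 1) := by positivity
    have hb : 0 ≤ 1 - t / (n + 1) := by
      rw [sub_nonneg, div_le_one hn1]
      linarith
    -- Mixing with `z₀`, on which `T` vanishes, scales `T z` down while staying in `K n`.
    refine ⟨n, (t / (n + 1)) • z + (1 - t / (n + 1)) • z₀, ⟨?_, ?_⟩, ?_⟩
    · exact convex_closedBall (0 : E) n (by simpa using hzn) (by simpa using hz₀n) ha hb (by ring)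
    · refine hF.convex_sublevel n (x := z) ?_ (y := z₀) ?_ ha hb (by ring)
      · exact hr.trans_le (EReal.coe_le_coe_iff.2 hrn)
      · exact hr₀.trans_le (EReal.coe_le_coe_iff.2 hr₀n)
    · rw [map_add, map_smul, map_smul, hTz₀, smul_zero, add_zero, hv, smul_smul, div_eq_inv_mul]
  obtain ⟨n, v₀, hv₀⟩ := nonempty_interior_of_iUnion_of_closed hD hDV
  obtain ⟨r, hr, hball⟩ := Metric.mem_nhds_iff.1 (mem_interior_iff_mem_nhds.1 hv₀)
  -- `D n` contains a ball around `v₀`, not around `0`. A preimage for a multiple of `-v₀` recentres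
  -- it: with weights `(n + 1) / q` and `(m + 1) / q`, the `v₀` terms cancel.
  obtain ⟨m, z₂, hz₂, hTz₂⟩ := mem_iUnion.1 (hDV ▸ mem_univ (-v₀) : -v₀ ∈ ⋃ n, D n)
  have hn1 : (0 : ℝ) < n + 1 := by positivity
  have hm1 : (0 : ℝ) < m + 1 := by positivity
  set q : ℝ := (n + 1) + (m + 1) with hq
  have hq0 : 0 < q := by positivity
  refine ⟨max n m, r / q, by positivity, fun v hv hvr => ?_⟩
  have hmem : v₀ + q • (⟨v, hv⟩ : V) ∈ D n := by
    apply hball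
    rw [Metric.mem_ball, dist_self_add_left, norm_smul, Real.norm_of_nonneg hq0.le, mul_comm]
    exact (lt_div_iff₀ hq0).1 hvr
  obtain ⟨z₁, hz₁, hTz₁⟩ := hmem
  refine ⟨((n + 1) / q) • z₁ + ((m + 1) / q) • z₂, ?_, ?_⟩
  · rw [map_add, map_smul, map_smul, hTz₁, hTz₂, smul_smul, smul_smul]
    have e1 : ((n : ℝ) + 1) / q * ((n : ℝ) + 1)⁻¹ = q⁻¹ := by field_simp
    have e2 : ((m : ℝ) + 1) / q * ((m : ℝ) + 1)⁻¹ = q⁻¹ := by field_simp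
    rw [e1, e2, ← smul_add]
    simp only [Submodule.coe_add, Submodule.coe_neg, Submodule.coe_smul]
    rw [add_comm (v₀ : Y), add_neg_cancel_right, smul_smul, inv_mul_cancel₀ hq0.ne', one_smul]
  · refine hF.convex_sublevel (max n m) (x := z₁) ?_ (y := z₂) ?_ (by positivity) (by positivity)
      (by rw [← add_div, ← hq, div_self hq0.ne'])
    · exact hz₁.2.trans (EReal.coe_le_coe_iff.2 (le_max_left _ _))
    · exact hz₂.2.trans (EReal.coe_le_coe_iff.2 (le_max_right _ _))

/-- Existence of a Lagrange multiplier for `min {F z | T z = 0}` under the Attouch-Brezis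
qualification condition. -/
theorem IsLscConvex.exists_multiplier {F : E → EReal} (hF : IsLscConvex F)
    (T : E →L[ℝ] Y) (V : Submodule ℝ Y) (hV : IsClosed (V : Set Y))
    (hcone : coneGen (T '' dom F) = (V : Set Y)) {μ : ℝ}
    (hμ : ∀ z, T z = 0 → (μ : EReal) ≤ F z) :
    ∃ w : Y, ∀ (z : E) (s : ℝ), F z ≤ (s : EReal) → μ + inner ℝ w (T z) ≤ s := by
  have : CompleteSpace V := hV.completeSpace_coe
  obtain ⟨N, ε, hε, hN⟩ := hF.exists_forall_norm_lt_exists_le T V hV hcone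
  -- Strict epigraph of the value function over `V`; the bound `N` gives it interior.
  let A : Set (V × ℝ) := {q | ∃ z, T z = q.1 ∧ ∃ s : ℝ, F z ≤ (s : EReal) ∧ s < q.2}
  have hA : Convex ℝ A := by
    rintro ⟨v, p⟩ ⟨z, hz, s, hs, hsp⟩ ⟨v', p'⟩ ⟨z', hz', s', hs', hsp'⟩ a b ha hb hab
    refine ⟨a • z + b • z', by simp [hz, hz'], a * s + b * s', hF.combo_le hs hs' ha hb hab, ?_⟩
    simp only [Prod.snd_add, Prod.smul_snd, smul_eq_mul] at *
    rcases ha.eq_or_lt with rfl | ha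
    · have : b = 1 := by linarith
      subst this
      linarith
    · nlinarith [mul_lt_mul_of_pos_left hsp ha, mul_le_mul_of_nonneg_left hsp'.le hb]
  have hint : ∀ t, N < t → ((0 : V), t) ∈ interior A := by
    intro t ht
    rw [mem_interior_iff_mem_nhds, nhds_prod_eq]
    refine mem_of_superset (prod_mem_prod (Metric.ball_mem_nhds 0 hε) (Ioi_mem_nhds ht)) ?_
    rintro ⟨v, p⟩ ⟨hv, hp⟩
    obtain ⟨z, hz, hzN⟩ := hN v v.2 (by simpa using hv)
    exact ⟨z, hz, N, hzN, hp⟩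
  have hnot : ((0 : V), μ) ∉ interior A := by
    intro h
    obtain ⟨z, hz, s, hs, hsμ⟩ := interior_subset h
    have := EReal.coe_le_coe_iff.1 ((hμ z hz).trans hs)
    exact absurd hsμ this.not_gt
  obtain ⟨φ, hφ⟩ := geometric_hahn_banach_open_point hA.interior isOpen_interior hnot
  have hφA : ∀ q ∈ A, φ q ≤ φ (0, μ) := by
    intro q hq
    have hcl : q ∈ closure (interior A) := by
      rw [hA.closure_interior_eq_closure_of_nonempty_interior
        ⟨_, hint (N + 1) (lt_add_one N)⟩]
      exact subset_closure hq
    exact closure_minimal (fun a ha => (hφ a ha).le) (isClosed_le φ.continuous continuous_const) hcl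
  have hsplit : ∀ (v : V) (t : ℝ), φ (v, t) = φ (v, 0) + t * φ (0, 1) := by
    intro v t
    rw [← smul_eq_mul, ← map_smul, ← map_add]
    simp
  set c := φ (0, 1) with hc
  -- The separating hyperplane is not vertical, since `A` has interior points above `(0, μ)`.
  have hc0 : c < 0 := by
    have h := hφ _ (hint (max N μ + 1) (by linarith [le_max_left N μ]))
    rw [hsplit, hsplit 0 μ] at h
    nlinarith [le_max_right N μ]
  let l : StrongDual ℝ V := (-c)⁻¹ • φ.comp (ContinuousLinearMap.inl ℝ V ℝ)
  refine ⟨((InnerProductSpace.toDual ℝ V).symm l : V), fun z s hs => ?_⟩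
  have hz : T z ∈ V := by
    have : T z ∈ coneGen (T '' dom F) :=
      ⟨1, one_pos, T z, ⟨z, hs.trans_lt (EReal.coe_lt_top s), rfl⟩, (one_smul _ _).symm⟩
    rwa [hcone] at this
  have hin : inner ℝ (((InnerProductSpace.toDual ℝ V).symm l : V) : Y) (T z) = l ⟨T z, hz⟩ :=
    InnerProductSpace.toDual_symm_apply (y := l) (x := (⟨T z, hz⟩ : V))
  rw [hin]
  -- `A` is strict, so `s` is approached from above.
  refine le_of_forall_gt_imp_ge_of_dense fun t ht => ?_
  have h := hφA (⟨T z, hz⟩, t) ⟨z, rfl, s, hs, ht⟩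
  rw [hsplit, hsplit 0 μ] at h
  have h00 : φ (0, 0) = 0 := map_zero φ
  have hl : l ⟨T z, hz⟩ = φ (⟨T z, hz⟩, 0) / (-c) := by
    simp [l, div_eq_inv_mul]
  rw [hl, ← le_sub_iff_add_le', div_le_iff₀ (by linarith)]
  rw [h00] at h
  linarith

end Perturbation

/-! ### Prolonging segments at relative interior points. -/

section RelativeInterior

variable {E : Type*} [NormedAddCommGroup E] [NormedSpace ℝ E]

/-- Segments ending at a relative interior point can be prolonged within the set. -/
theorem eventually_add_smul_mem_of_mem_intrinsicInterior {s : Set E} {x y : E}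
    (hx : x ∈ intrinsicInterior ℝ s) (hy : y ∈ s) :
    ∀ᶠ t in 𝓝 (0 : ℝ), x + t • (x - y) ∈ s := by
  obtain ⟨x', hx', rfl⟩ := mem_intrinsicInterior.1 hx
  let γ : ℝ → affineSpan ℝ s := fun t =>
    ⟨AffineMap.lineMap (x' : E) y (-t), AffineMap.lineMap_mem _ x'.2 (subset_affineSpan ℝ s hy)⟩
  have hγ : ∀ t, (γ t : E) = x' + t • ((x' : E) - y) := by
    intro t
    simp only [γ, AffineMap.lineMap_apply, vsub_eq_sub, vadd_eq_add]
    module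
  have hcont : Continuous γ := by
    refine Continuous.subtype_mk (f := fun t => (γ t : E)) ?_ _
    simp only [hγ]
    fun_prop
  have h0 : γ 0 = x' := by
    apply Subtype.ext
    simp [hγ]
  have : ∀ᶠ t in 𝓝 (0 : ℝ), γ t ∈ ((↑) ⁻¹' s : Set (affineSpan ℝ s)) :=
    hcont.continuousAt.eventually_mem (by rw [h0]; exact mem_interior_iff_mem_nhds.1 hx')
  filter_upwards [this] with t ht
  rw [← hγ]
  exact ht

end RelativeInterior

/-! ### Cones that are subspaces. -/

section Cone

variable {E : Type*} [AddCommGroup E] [Module ℝ E]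

/-- Convexity gives sums, and `hneg` gives opposites. -/
theorem coneGen_eq_submodule {S : Set E} (hS : Convex ℝ S) (h0 : (0 : E) ∈ S)
    (hneg : ∀ s ∈ S, ∃ t : ℝ, 0 < t ∧ -(t • s) ∈ S) :
    ∃ V : Submodule ℝ E, coneGen S = (V : Set E) := by
  have hzero : (0 : E) ∈ coneGen S := ⟨1, one_pos, 0, h0, by simp⟩
  have hpos : ∀ c : ℝ, 0 < c → ∀ z ∈ coneGen S, c • z ∈ coneGen S := by
    rintro c hc _ ⟨t, ht, s, hs, rfl⟩
    exact ⟨c * t, mul_pos hc ht, s, hs, smul_smul _ _ _⟩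
  have hneg' : ∀ z ∈ coneGen S, -z ∈ coneGen S := by
    rintro _ ⟨t, ht, s, hs, rfl⟩
    obtain ⟨r, hr, hrs⟩ := hneg s hs
    refine ⟨t / r, div_pos ht hr, _, hrs, ?_⟩
    rw [smul_neg, smul_smul, div_mul_cancel₀ _ hr.ne']
  refine ⟨{ carrier := coneGen S, zero_mem' := hzero, add_mem' := ?_, smul_mem' := ?_ }, rfl⟩
  · rintro _ _ ⟨t, ht, s, hs, rfl⟩ ⟨t', ht', s', hs', rfl⟩
    have hp : 0 < t + t' := add_pos ht ht'
    refine ⟨t + t', hp, (t / (t + t')) • s + (t' / (t + t')) • s',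
      hS hs hs' (by positivity) (by positivity) (by field_simp), ?_⟩
    rw [smul_add, smul_smul, smul_smul, mul_div_cancel₀ _ hp.ne', mul_div_cancel₀ _ hp.ne']
  · intro c z hz
    rcases lt_trichotomy c 0 with hc | rfl | hc
    · simpa using hneg' _ (hpos (-c) (by linarith) z hz)
    · simpa using hzero
    · exact hpos c hc z hz

end Cone

theorem coe_sum {ι : Type*} (s : Finset ι) (c : ι → ℝ) :
    ((∑ i ∈ s, c i : ℝ) : EReal) = ∑ i ∈ s, (c i : EReal) :=
  map_sum (⟨⟨Real.toEReal, EReal.coe_zero⟩, EReal.coe_add⟩ : ℝ →+ EReal) c s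

/-! ### The doubled problem and its optimality conditions. -/

section Composite

variable {H : Type*} [NormedAddCommGroup H] [InnerProductSpace ℝ H]
  {p : ℕ} {G : Fin p → Type*} [∀ k, NormedAddCommGroup (G k)] [∀ k, InnerProductSpace ℝ (G k)]

/-- The separable sum `(x, y) ↦ f x + ∑ k, g k (y k)` on the Hilbert sum of all the spaces. -/
noncomputable def separableSum (f : H → EReal) (g : ∀ k, G k → EReal) :
    WithLp 2 (H × PiLp 2 G) → EReal :=
  fun z => f z.fst + ∑ k, g k (z.snd k)

/-- The operator `(x, y) ↦ (L k x - y k)ₖ`. -/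
noncomputable def diffMap (L : ∀ k, H →L[ℝ] G k) : WithLp 2 (H × PiLp 2 G) →L[ℝ] PiLp 2 G :=
  (PiLp.continuousLinearEquiv 2 ℝ G).symm.toContinuousLinearMap ∘L
    ContinuousLinearMap.pi fun k =>
      L k ∘L WithLp.fstL 2 ℝ H (PiLp 2 G) - PiLp.proj 2 G k ∘L WithLp.sndL 2 ℝ H (PiLp 2 G)

theorem diffMap_apply (L : ∀ k, H →L[ℝ] G k) (z : WithLp 2 (H × PiLp 2 G)) (k : Fin p) :
    diffMap L z k = L k z.fst - z.snd k :=
  rfl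

theorem isLscConvex_separableSum {f : H → EReal} {g : ∀ k, G k → EReal} (hf : IsLscConvex f)
    (hg : ∀ k, IsLscConvex (g k)) : IsLscConvex (separableSum f g) :=
  (hf.comp (WithLp.fstL 2 ℝ H (PiLp 2 G))).add <| IsLscConvex.sum
    (fun k => (hg k).comp (PiLp.proj 2 G k ∘L WithLp.sndL 2 ℝ H (PiLp 2 G))) Finset.univ

theorem mem_dom_separableSum {f : H → EReal} {g : ∀ k, G k → EReal} (hf : IsLscConvex f)
    (hg : ∀ k, IsLscConvex (g k)) {z : WithLp 2 (H × PiLp 2 G)} :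
    z ∈ dom (separableSum f g) ↔ z.fst ∈ dom f ∧ ∀ k, z.snd k ∈ dom (g k) := by
  have hb : ∀ k ∈ Finset.univ, g k (z.snd k) ≠ ⊥ := fun k _ => (hg k).ne_bot _
  simp only [dom, mem_ofPred_eq, separableSum]
  rw [lt_top_iff_ne_top, EReal.add_ne_top_iff_ne_top₂ (hf.ne_bot _) (sum_ne_bot hb),
    ← lt_top_iff_ne_top, ← lt_top_iff_ne_top, sum_lt_top_iff hb]
  simp

theorem diffMap_image_dom {f : H → EReal} {g : ∀ k, G k → EReal} (hf : IsLscConvex f)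
    (hg : ∀ k, IsLscConvex (g k)) (L : ∀ k, H →L[ℝ] G k) :
    diffMap L '' dom (separableSum f g) = diffSet f g L := by
  ext s
  constructor
  · rintro ⟨z, hz, rfl⟩
    obtain ⟨h1, h2⟩ := (mem_dom_separableSum hf hg).1 hz
    exact ⟨z.fst, h1, fun k => z.snd k, h2, rfl⟩
  · rintro ⟨x, hx, y, hy, rfl⟩
    exact ⟨WithLp.toLp 2 (x, WithLp.toLp 2 y), (mem_dom_separableSum hf hg).2 ⟨hx, hy⟩, rfl⟩

theorem coneGen_diffSet_eq_univ {f : H → EReal} {g : ∀ k, G k → EReal} (hf : (dom f).Nonempty)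
    (hg : ∀ k y, y ∈ dom (g k)) (L : ∀ k, H →L[ℝ] G k) : coneGen (diffSet f g L) = univ := by
  obtain ⟨x, hx⟩ := hf
  refine eq_univ_of_forall fun v => ⟨1, one_pos, v, ⟨x, hx, fun k => L k x - v k,
    fun k => hg k _, ?_⟩, (one_smul _ _).symm⟩
  ext k
  simp

theorem coneGen_diffSet_eq_submodule {f : H → EReal} {g : ∀ k, G k → EReal} (hf : IsLscConvex f)
    (hg : ∀ k, IsLscConvex (g k)) (L : ∀ k, H →L[ℝ] G k) {x : H}
    (hx : x ∈ intrinsicInterior ℝ (dom f))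
    (hLx : ∀ k, L k x ∈ intrinsicInterior ℝ (dom (g k))) :
    ∃ V : Submodule ℝ (PiLp 2 G), coneGen (diffSet f g L) = (V : Set (PiLp 2 G)) := by
  refine coneGen_eq_submodule ?_ ?_ ?_
  · rw [← diffMap_image_dom hf hg L]
    exact (isLscConvex_separableSum hf hg).convex_dom.linear_image (diffMap L).toLinearMap
  · refine ⟨x, intrinsicInterior_subset hx, fun k => L k x,
      fun k => intrinsicInterior_subset (hLx k), ?_⟩
    ext k
    simp
  · rintro _ ⟨x', hx', y', hy', rfl⟩
    have h1 := eventually_add_smul_mem_of_mem_intrinsicInterior hx hx'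
    have h2 : ∀ᶠ t in 𝓝 (0 : ℝ), ∀ k, L k x + t • (L k x - y' k) ∈ dom (g k) :=
      eventually_all.2 fun k => eventually_add_smul_mem_of_mem_intrinsicInterior (hLx k) (hy' k)
    -- There are finitely many `k`, so one `t > 0` prolongs all segments past `x` and `L k x`; the
    -- prolonged points have difference `-(t • s)`.
    obtain ⟨t, ⟨ht1, ht2⟩, ht⟩ :=
      (((h1.and h2).filter_mono nhdsWithin_le_nhds).and self_mem_nhdsWithin :
        ∀ᶠ t in 𝓝[>] (0 : ℝ), _ ∧ t ∈ Ioi (0 : ℝ)).exists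
    refine ⟨t, ht, _, ht1, _, ht2, ?_⟩
    ext k
    simp only [PiLp.neg_apply, PiLp.smul_apply, map_add, map_smul, map_sub]
    module

variable [CompleteSpace H] [∀ k, CompleteSpace (G k)]

/-- A multiplier for the separable problem yields a zero of the sum of the subdifferentials. -/
theorem mem_zer_of_multiplier {f : H → EReal} {g : ∀ k, G k → EReal} {L : ∀ k, H →L[ℝ] G k}
    {x : H} {a : ℝ} {b : Fin p → ℝ} (hf : ∀ z, f z ≠ ⊥) (hg : ∀ k y, g k y ≠ ⊥)
    (ha : f x = a) (hb : ∀ k, g k (L k x) = b k) {w : ∀ k, G k}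
    (hw : ∀ (z : H) (y : ∀ k, G k) (s : ℝ), f z + ∑ k, g k (y k) ≤ (s : EReal) →
      (a + ∑ k, b k) + ∑ k, inner ℝ (w k) (L k z - y k) ≤ s) :
    x ∈ zer (subdifferential f + ∑ k, compose (L k) (subdifferential (g k))) := by
  have h1 : ∑ k, ContinuousLinearMap.adjoint (L k) (w k) ∈ subdifferential f x := by
    intro z
    by_cases hz : f z = ⊤
    · rw [hz]
      exact le_top
    lift f z to ℝ using ⟨hz, hf z⟩ with s hs
    -- Freezing `y` at `(L k x)ₖ` isolates `f`.
    have := hw z (fun k => L k x) (s + ∑ k, b k) <| by simp [← hs, hb, coe_sum]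
    simp only [← map_sub, ← ContinuousLinearMap.adjoint_inner_left, ← sum_inner] at this
    rw [ha, real_inner_comm]
    norm_cast
    linarith
  have h2 : ∀ k, -w k ∈ subdifferential (g k) (L k x) := by
    intro j y
    by_cases hy : g j y = ⊤
    · rw [hy]
      exact le_top
    lift g j y to ℝ using ⟨hy, hg j y⟩ with s hs
    have hval : ∀ k, g k (Function.update (fun k => L k x) j y k) =
        (Function.update b j s k : ℝ) := by
      intro k
      rcases eq_or_ne k j with rfl | hk
      · simp [hs]
      · simp [hk, hb]
    -- Freezing all but the `j`-th component isolates `g j`.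
    have := hw x (Function.update (fun k => L k x) j y) (a + ∑ k, Function.update b j s k) <| by
      rw [EReal.coe_add, coe_sum, ha]
      simp only [hval, le_refl]
    have hsum : ∑ k, inner ℝ (w k) (L k x - Function.update (fun k => L k x) j y k) =
        inner ℝ (w j) (L j x - y) := by
      rw [Finset.sum_eq_single j (fun k _ hk => by simp [hk]) (by simp), Function.update_self]
    rw [hsum, Finset.sum_update_of_mem (Finset.mem_univ j),
      ← Finset.add_sum_erase _ b (Finset.mem_univ j), Finset.sdiff_singleton_eq_erase] at this
    rw [hb, inner_neg_right, real_inner_comm, ← inner_neg_right, neg_sub]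
    norm_cast
    linarith
  change (0 : H) ∈ (subdifferential f + ∑ k, compose (L k) (subdifferential (g k))) x
  rw [Pi.add_apply, Finset.sum_apply]
  refine ⟨_, h1, _, Set.finsetSum_mem_finsetSum Finset.univ _ _
    fun k _ => mem_image_of_mem _ (h2 k), ?_⟩
  simp

end Composite

end ConvexComposite

theorem proposition4p2
    {H : Type*} [NormedAddCommGroup H] [InnerProductSpace ℝ H] [CompleteSpace H]
    [TopologicalSpace.SeparableSpace H]
    {p : ℕ} {G : Fin p → Type*} [∀ k, NormedAddCommGroup (G k)]
    [∀ k, InnerProductSpace ℝ (G k)] [∀ k, CompleteSpace (G k)]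
    [∀ k, TopologicalSpace.SeparableSpace (G k)]
    (f : H → EReal) (hf : ConvexComposite.Gamma0 f)
    (g : ∀ k, G k → EReal) (hg : ∀ k, ConvexComposite.Gamma0 (g k))
    (L : ∀ k, H →L[ℝ] G k) (hL : ∀ k, L k ≠ 0)
    (hcoercive : Tendsto (fun x => f x + ∑ k, g k (L k x))
      (comap (fun x : H => ‖x‖) atTop) (𝓝 (⊤ : EReal)))
    (hqual :
      (∃ V : Submodule ℝ (PiLp 2 G), IsClosed (V : Set (PiLp 2 G)) ∧
        ConvexComposite.coneGen (ConvexComposite.diffSet f g L) = (V : Set (PiLp 2 G)))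
      ∨ (∀ k y, ∃ r : ℝ, g k y = (r : EReal))
      ∨ (FiniteDimensional ℝ H ∧ (∀ k, FiniteDimensional ℝ (G k)) ∧
          ∃ x ∈ intrinsicInterior ℝ (ConvexComposite.dom f),
            ∀ k, L k x ∈ intrinsicInterior ℝ (ConvexComposite.dom (g k)))) :
    (ConvexComposite.zer (ConvexComposite.subdifferential f +
      ∑ k, ConvexComposite.compose (L k)
        (ConvexComposite.subdifferential (g k)))).Nonempty := by
  open ConvexComposite in
  have hf' := hf.isLscConvex
  have hg' := fun k => (hg k).isLscConvex
  obtain ⟨V, hVc, hV⟩ : ∃ V : Submodule ℝ (PiLp 2 G), IsClosed (V : Set (PiLp 2 G)) ∧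
      coneGen (diffSet f g L) = (V : Set (PiLp 2 G)) := by
    rcases hqual with h | h | ⟨-, hfin, x, hx, hLx⟩
    · exact h
    · refine ⟨⊤, isClosed_univ, coneGen_diffSet_eq_univ hf.nonempty_dom (fun k y => ?_) L⟩
      obtain ⟨r, hr⟩ := h k y
      exact hr.trans_lt (EReal.coe_lt_top r)
    · obtain ⟨V, hV⟩ := coneGen_diffSet_eq_submodule hf' hg' L hx hLx
      -- Finite dimension serves only to close `V`.
      exact ⟨V, V.closed_of_finiteDimensional, hV⟩
  rw [← diffMap_image_dom hf' hg' L] at hV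
  -- That `0` lies in the cone provides a feasible point of `dom F`, so the composite objective is
  -- not identically `⊤`.
  obtain ⟨t, ht, _, ⟨z, hz, rfl⟩, h0⟩ : (0 : PiLp 2 G) ∈
      coneGen (diffMap L '' dom (separableSum f g)) := hV ▸ V.zero_mem
  have key : ∀ z, diffMap L z = 0 → separableSum f g z = f z.fst + ∑ k, g k (L k z.fst) := by
    intro z hz
    have : ∀ k, z.snd k = L k z.fst := fun k =>
      (sub_eq_zero.1 ((diffMap_apply L z k).symm.trans (by rw [hz]; rfl))).symm
    simp only [separableSum, this]
  have hz0 : diffMap L z = 0 := (smul_eq_zero.1 h0.symm).resolve_left ht.ne'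
  have hh : IsLscConvex fun x => f x + ∑ k, g k (L k x) :=
    hf'.add (IsLscConvex.sum (fun k => (hg' k).comp (L k)) Finset.univ)
  have hzdom : f z.fst + ∑ k, g k (L k z.fst) < ⊤ := key z hz0 ▸ hz
  obtain ⟨x, hx⟩ := hh.exists_forall_le ⟨z.fst, hzdom⟩ hcoercive
  obtain ⟨hxf, hxg⟩ := (mem_dom_separableSum hf' hg'
    (z := WithLp.toLp 2 (x, WithLp.toLp 2 fun k => L k x))).1 ((hx z.fst).trans_lt hzdom)
  obtain ⟨a, ha⟩ := hf'.exists_coe_eq (x := x) hxf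
  choose b hb using fun k => (hg' k).exists_coe_eq (x := L k x) (hxg k)
  have hμ : ((a + ∑ k, b k : ℝ) : EReal) = f x + ∑ k, g k (L k x) := by
    rw [EReal.coe_add, coe_sum, ha]
    exact congrArg _ (Finset.sum_congr rfl fun k _ => (hb k).symm)
  obtain ⟨w, hw⟩ := (isLscConvex_separableSum hf' hg').exists_multiplier (diffMap L) V hVc hV
    (μ := a + ∑ k, b k) fun z hz => by rw [key z hz, hμ]; exact hx _
  exact ⟨x, mem_zer_of_multiplier hf.ne_bot (fun k => (hg k).ne_bot) ha hb (w := w)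
    fun z y s hs => by
      simpa [PiLp.inner_apply, diffMap_apply] using
        hw (WithLp.toLp 2 (z, WithLp.toLp 2 y)) s hs⟩
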